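/- Fix a positive integer $\Delta$. All graphs are simple and undirected. Let $\mathbf{Gr}$ be the set of isomorphism classes $[G,o]$ of rooted graphs $(G,o)$, where $G$ is a countable connected graph with $\deg_G(x)\le\Delta$ for all $x\in V(G)$ and $o\in V(G)$. Let $\vec{\mathbf{Gr}}$ be the set of isomorphism classes $[G,o_1,o_2]$ of birooted graphs, where $G$ is as before, $o_1\in V(G)$, and $o_2$ is a neighbour of $o_1$. Let $B_G(o,r)$ be the subgraph of $G$ induced by the vertices at graph distance at most $r$ from $o$. Equip $\mathbf{Gr}$ with the metric $\rho$ for which $\rho([G,o],[H,p])=2^{-r}$, $r=\sup\{s\in\mathbb{N} : [B_G(o,s),o]=[B_H(p,s),p]\}$, whenever $[G,o]\ne[H,p]$. Equip $\vec{\mathbf{Gr}}$ with the analogous metric $\vec\rho$, for which $\vec\rho([G,o_1,o_2],[H,p_1,p_2])=2^{-r}$, $r=\sup\{s\ge 1 : [B_G(o_1,s),o_1,o_2]=[B_H(p_1,s),p_1,p_2]\}$ (with $\sup\emptyset=0$), whenever the two classes differ. Both spaces carry their Borel $\sigma$-algebras. For a probability measure $\mu$ on $\mathbf{Gr}$, let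 $\vec\mu$ be the measure on $\vec{\mathbf{Gr}}$ given by $$\vec\mu(A)=\int_{\mathbf{Gr}} \bigl|\{x\in V(G) : x \text{ is adjacent to } o,\ [G,o,x]\in A\}\bigr|\,d\mu([G,o])$$ for all Borel sets $A\subseteq\vec{\mathbf{Gr}}$. Let $\iota:\vec{\mathbf{Gr}}\to\vec{\mathbf{Gr}}$ be the flip $\iota[G,x,y]=[G,y,x]$. The measure $\mu$ is called involution invariant if $\iota_*(\vec\mu)=\vec\mu$. **Theorem.** If $(\mu_n)_{n=1}^\infty$ is a sequence of involution invariant probability measures on $\mathbf{Gr}$ that converges weakly to a probability measure $\mu$ on $\mathbf{Gr}$, then $\mu$ is involution invariant. -/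

import Mathlib

open MeasureTheory Filter Topology
open scoped ENNReal

namespace SimpleGraph

variable {V W : Type} {G : SimpleGraph V} {H : SimpleGraph W}

/-- The set of vertices at graph distance at most `r` from `o`. It is meant for connected graphs
(`SimpleGraph.dist` has the value `0` on pairs of vertices that are not joined by a walk). -/
def distBall (G : SimpleGraph V) (o : V) (r : ℕ) : Set V := {x | G.dist o x ≤ r}

theorem root_mem_distBall (o : V) (r : ℕ) : o ∈ G.distBall o r := by simp [distBall]

theorem adj_mem_distBall {o x : V} (h : G.Adj o x) {r : ℕ} (hr : 1 ≤ r) :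
    x ∈ G.distBall o r := by
  have : G.dist o x = 1 := dist_eq_one_iff_adj.mpr h
  simp only [distBall, Set.mem_ofPred_eq]
  omega

theorem dist_apply_le (φ : G →g H) (hG : G.Connected) (x y : V) :
    H.dist (φ x) (φ y) ≤ G.dist x y := by
  obtain ⟨p, hp⟩ := hG.exists_walk_length_eq_dist x y
  rw [← hp, ← Walk.length_map φ p]
  exact dist_le _

theorem exists_induced_walk (hG : G.Connected) (o : V) (r : ℕ) (x : V)
    (hx : x ∈ G.distBall o r) :
    ∃ p : (G.induce (G.distBall o r)).Walk ⟨o, root_mem_distBall o r⟩ ⟨x, hx⟩,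
      p.length = G.dist o x := by
  classical
  obtain ⟨p, hp⟩ := hG.exists_walk_length_eq_dist o x
  have hs : ∀ y ∈ p.support, y ∈ G.distBall o r := by
    intro y hy
    have h1 := dist_le (p.takeUntil y hy)
    have h2 := p.length_takeUntil_le_length hy
    simp only [distBall, Set.mem_ofPred_eq] at hx ⊢
    omega
  refine ⟨p.induce _ hs, ?_⟩
  have := Walk.length_map (SimpleGraph.Embedding.induce (G.distBall o r)).toHom (p.induce _ hs)
  rw [← this, Walk.map_induce]
  exact hp

theorem connected_induce_distBall (hG : G.Connected) (o : V) (r : ℕ) :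
    (G.induce (G.distBall o r)).Connected := by
  have key : ∀ x : G.distBall o r,
      (G.induce (G.distBall o r)).Reachable ⟨o, root_mem_distBall o r⟩ x := fun x =>
    (exists_induced_walk hG o r x.1 x.2).elim fun p _ => p.reachable
  have : Nonempty (G.distBall o r) := ⟨⟨o, root_mem_distBall o r⟩⟩
  exact ⟨fun x y => (key x).symm.trans (key y)⟩

theorem dist_induce_distBall (hG : G.Connected) (o : V) (r : ℕ) (x : G.distBall o r) :
    (G.induce (G.distBall o r)).dist ⟨o, root_mem_distBall o r⟩ x = G.dist o x := by
  apply le_antisymm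
  · obtain ⟨p, hp⟩ := exists_induced_walk hG o r x.1 x.2
    rw [← hp]
    exact dist_le p
  · exact dist_apply_le (SimpleGraph.Embedding.induce (G.distBall o r)).toHom
      (connected_induce_distBall hG o r) ⟨o, root_mem_distBall o r⟩ x

theorem iso_dist_eq (φ : G ≃g H) (hG : G.Connected) (hH : H.Connected) (x y : V) :
    H.dist (φ x) (φ y) = G.dist x y := by
  apply le_antisymm (dist_apply_le φ.toHom hG x y)
  have := dist_apply_le φ.symm.toHom hH (φ x) (φ y)
  simpa using this

/-- An isomorphism of graphs that carries the vertex set `s` onto the vertex set `t` restricts to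
an isomorphism of the induced subgraphs. -/
def isoInduce (φ : G ≃g H) (s : Set V) (t : Set W) (h : ∀ x, x ∈ s ↔ φ x ∈ t) :
    G.induce s ≃g H.induce t where
  toEquiv := φ.toEquiv.subtypeEquiv h
  map_rel_iff' := by
    intro a b
    exact φ.map_adj_iff

theorem mem_distBall_iff_of_iso (φ : G ≃g H) (hG : G.Connected) (hH : H.Connected)
    {o : V} {p : W} (hφ : φ o = p) (r : ℕ) (x : V) :
    x ∈ G.distBall o r ↔ φ x ∈ H.distBall p r := by
  subst hφ
  simp only [distBall, Set.mem_ofPred_eq, iso_dist_eq φ hG hH]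

/-- The ball of radius `r` inside the ball of radius `s` is the ball of radius `r`
when `r ≤ s`. -/
def isoBallBall (hG : G.Connected) (o : V) {r s : ℕ} (hrs : r ≤ s) :
    ((G.induce (G.distBall o s)).induce
      ((G.induce (G.distBall o s)).distBall ⟨o, root_mem_distBall o s⟩ r)) ≃g
    G.induce (G.distBall o r) where
  toFun x := ⟨x.1.1, by
    have h := x.2
    simp only [distBall, Set.mem_ofPred_eq] at h ⊢
    rw [← dist_induce_distBall hG o s x.1]
    exact h⟩
  invFun x := ⟨⟨x.1, le_trans x.2 hrs⟩, by
    simp only [distBall]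
    exact (dist_induce_distBall hG o s ⟨x.1, le_trans x.2 hrs⟩).le.trans x.2⟩
  left_inv _ := rfl
  right_inv _ := rfl
  map_rel_iff' := Iff.rfl

theorem finite_distBall (hG : G.Connected) (hfin : ∀ x, (G.neighborSet x).Finite) (o : V) (r : ℕ) :
    (G.distBall o r).Finite := by
  induction r with
  | zero =>
    refine (Set.finite_singleton o).subset ?_
    intro x hx
    have : G.dist o x = 0 := Nat.le_zero.mp hx
    exact ((hG.dist_eq_zero_iff).mp this).symm
  | succ r ih =>
    refine (ih.union (ih.biUnion fun y _ => hfin y)).subset ?_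
    intro x hx
    by_cases h : G.dist o x ≤ r
    · exact Or.inl h
    · right
      obtain ⟨p, hp⟩ := hG.exists_walk_length_eq_dist x o
      cases p with
      | nil => simp at h
      | @cons _ y _ hxy q =>
        refine Set.mem_biUnion (x := y) ?_ hxy.symm
        have h1 := dist_le q
        rw [Walk.length_cons, dist_comm] at hp
        rw [dist_comm] at h1
        simp only [distBall, Set.mem_ofPred_eq] at hx ⊢
        omega

/-- Compactness: two connected, locally finite rooted graphs whose vertices carry marks are
isomorphic if all their balls around the root are. -/
theorem exists_iso_of_forall_ball (hG : G.Connected) (hH : H.Connected)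
    (hGf : ∀ x, (G.neighborSet x).Finite) (hHf : ∀ x, (H.neighborSet x).Finite)
    (o : V) (p : W) (c : V → Prop) (d : W → Prop)
    (h : ∀ n : ℕ, ∃ s, n ≤ s ∧ ∃ φ : G.induce (G.distBall o s) ≃g H.induce (H.distBall p s),
      (φ ⟨o, root_mem_distBall o s⟩).1 = p ∧ ∀ x, c x.1 ↔ d (φ x).1) :
    ∃ φ : G ≃g H, φ o = p ∧ ∀ x, c x ↔ d (φ x) := by
  classical
  choose s hs φ hφo hφc using h
  let f : ℕ → V → W := fun n x =>
    if hx : x ∈ G.distBall o (s n) then (φ n ⟨x, hx⟩).1 else p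
  let g : ℕ → W → V := fun n y =>
    if hy : y ∈ H.distBall p (s n) then ((φ n).symm ⟨y, hy⟩).1 else o
  have hf : ∀ n x (hx : x ∈ G.distBall o (s n)), f n x = (φ n ⟨x, hx⟩).1 := fun n x hx =>
    dif_pos hx
  have hg : ∀ n y (hy : y ∈ H.distBall p (s n)), g n y = ((φ n).symm ⟨y, hy⟩).1 := fun n y hy =>
    dif_pos hy
  have hdist : ∀ n x (hx : x ∈ G.distBall o (s n)), H.dist p (φ n ⟨x, hx⟩).1 = G.dist o x := by
    intro n x hx
    rw [← dist_induce_distBall hG o (s n) ⟨x, hx⟩,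
      ← dist_induce_distBall hH p (s n) (φ n ⟨x, hx⟩),
      ← iso_dist_eq (φ n) (connected_induce_distBall hG o (s n))
        (connected_induce_distBall hH p (s n))]
    congr 1
    exact Subtype.ext (hφo n).symm
  have hdist' : ∀ n y (hy : y ∈ H.distBall p (s n)),
      G.dist o ((φ n).symm ⟨y, hy⟩).1 = H.dist p y := by
    intro n y hy
    have := hdist n _ ((φ n).symm ⟨y, hy⟩).2
    rw [← this]
    simp
  let U : Ultrafilter ℕ := hyperfilter ℕ
  have hev : ∀ m : ℕ, ∀ᶠ n in (U : Filter ℕ), m ≤ s n := by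
    intro m
    have : ∀ᶠ n in atTop, m ≤ s n :=
      (eventually_ge_atTop m).mono fun n hn => hn.trans (hs n)
    exact (Nat.hyperfilter_le_atTop) this
  have hF : ∀ x, ∃ y, ∀ᶠ n in (U : Filter ℕ), f n x = y := by
    intro x
    have hfin := finite_distBall hH hHf p (G.dist o x)
    have : ∀ᶠ n in (U : Filter ℕ), ∃ y ∈ H.distBall p (G.dist o x), f n x = y := by
      filter_upwards [hev (G.dist o x)] with n hn
      refine ⟨_, ?_, rfl⟩
      rw [hf n x hn]
      exact (hdist n x hn).le
    obtain ⟨y, _, hy⟩ := (Ultrafilter.eventually_exists_mem_iff hfin).mp this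
    exact ⟨y, hy⟩
  have hF' : ∀ y, ∃ x, ∀ᶠ n in (U : Filter ℕ), g n y = x := by
    intro y
    have hfin := finite_distBall hG hGf o (H.dist p y)
    have : ∀ᶠ n in (U : Filter ℕ), ∃ x ∈ G.distBall o (H.dist p y), g n y = x := by
      filter_upwards [hev (H.dist p y)] with n hn
      refine ⟨_, ?_, rfl⟩
      rw [hg n y hn]
      exact (hdist' n y hn).le
    obtain ⟨x, _, hx⟩ := (Ultrafilter.eventually_exists_mem_iff hfin).mp this
    exact ⟨x, hx⟩
  choose F hF using hF
  choose K hK using hF'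
  have hKF : ∀ x, K (F x) = x := by
    intro x
    obtain ⟨n, h1, h2, h3⟩ := ((hF x).and ((hK (F x)).and (hev (G.dist o x)))).exists
    rw [← h2, ← h1, hf n x h3, hg n _ (φ n ⟨x, h3⟩).2]
    simp
  have hFK : ∀ y, F (K y) = y := by
    intro y
    obtain ⟨n, h1, h2, h3⟩ := ((hK y).and ((hF (K y)).and (hev (H.dist p y)))).exists
    rw [← h2, ← h1, hg n y h3, hf n _ ((φ n).symm ⟨y, h3⟩).2]
    simp
  refine ⟨⟨⟨F, K, hKF, hFK⟩, ?_⟩, ?_, ?_⟩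
  · intro x y
    obtain ⟨n, h1, h2, h3, h4⟩ := ((hF x).and ((hF y).and
      ((hev (G.dist o x)).and (hev (G.dist o y))))).exists
    change H.Adj (F x) (F y) ↔ G.Adj x y
    rw [← h1, ← h2, hf n x h3, hf n y h4]
    exact (φ n).map_adj_iff (v := ⟨x, h3⟩) (w := ⟨y, h4⟩)
  · obtain ⟨n, h1⟩ := (hF o).exists
    change F o = p
    rw [← h1, hf n o (root_mem_distBall o _), hφo]
  · intro x
    obtain ⟨n, h1, h3⟩ := ((hF x).and (hev (G.dist o x))).exists
    change c x ↔ d (F x)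
    rw [← h1, hf n x h3]
    exact hφc n ⟨x, h3⟩

end SimpleGraph

/-! ### Rooted graphs -/

/-- A countable, connected rooted graph `(G, o)` with all degrees at most `Δ`. -/
structure RootedGraph (Δ : ℕ) where
  V : Type
  graph : SimpleGraph V
  root : V
  countable : Countable V
  connected : graph.Connected
  degree_le : ∀ x, (graph.neighborSet x).encard ≤ Δ

/-- A countable, connected birooted graph `(G, o₁, o₂)` with all degrees at most `Δ`: the second
root is a neighbour of the first one. -/
structure BirootedGraph (Δ : ℕ) extends RootedGraph Δ where
  root₂ : V
  adj : graph.Adj root root₂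

namespace RootedGraph

variable {Δ : ℕ}

theorem finite_neighborSet (G : RootedGraph Δ) (x : G.V) : (G.graph.neighborSet x).Finite :=
  Set.finite_of_encard_le_coe (G.degree_le x)

/-- Isomorphism of rooted graphs. -/
instance isoSetoid (Δ : ℕ) : Setoid (RootedGraph Δ) where
  r G H := ∃ φ : G.graph ≃g H.graph, φ G.root = H.root
  iseqv :=
    ⟨fun _ => ⟨SimpleGraph.Iso.refl, rfl⟩,
      fun ⟨φ, h⟩ => ⟨φ.symm, by rw [← h]; exact φ.symm_apply_apply _⟩,
      fun ⟨φ, h⟩ ⟨ψ, k⟩ => ⟨φ.trans ψ, by rw [← k, ← h]; rfl⟩⟩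

/-- The rooted graph `(B_G(o, r), o)`, where `B_G(o, r)` is the subgraph induced by the vertices at
distance at most `r` from `o`. -/
def ball (r : ℕ) (G : RootedGraph Δ) : RootedGraph Δ where
  V := G.graph.distBall G.root r
  graph := G.graph.induce (G.graph.distBall G.root r)
  root := ⟨G.root, SimpleGraph.root_mem_distBall _ _⟩
  countable := by
    have := G.countable
    infer_instance
  connected := SimpleGraph.connected_induce_distBall G.connected _ _
  degree_le x := by
    refine le_trans ?_ (G.degree_le x.1)
    rw [← Subtype.val_injective.encard_image]
    apply Set.encard_le_encard
    rintro _ ⟨y, hy, rfl⟩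
    exact hy

theorem ball_equiv {G H : RootedGraph Δ} (r : ℕ) (h : G ≈ H) : ball r G ≈ ball r H := by
  obtain ⟨φ, hφ⟩ := h
  exact ⟨SimpleGraph.isoInduce φ _ _
    (SimpleGraph.mem_distBall_iff_of_iso φ G.connected H.connected hφ r), Subtype.ext hφ⟩

theorem ball_ball_equiv (G : RootedGraph Δ) {r s : ℕ} (h : r ≤ s) :
    ball r (ball s G) ≈ ball r G :=
  ⟨SimpleGraph.isoBallBall G.connected G.root h, rfl⟩

/-- The birooted graph `(G, o, x)` obtained from `(G, o)` and a neighbour `x` of `o`. -/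
def withRoot₂ (G : RootedGraph Δ) (x : G.V) (h : G.graph.Adj G.root x) : BirootedGraph Δ :=
  { G with root₂ := x, adj := h }

end RootedGraph

namespace BirootedGraph

variable {Δ : ℕ}

/-- Isomorphism of birooted graphs. -/
instance isoSetoid (Δ : ℕ) : Setoid (BirootedGraph Δ) where
  r G H := ∃ φ : G.graph ≃g H.graph, φ G.root = H.root ∧ φ G.root₂ = H.root₂
  iseqv :=
    ⟨fun _ => ⟨SimpleGraph.Iso.refl, rfl, rfl⟩,
      fun ⟨φ, h, h'⟩ => ⟨φ.symm, by rw [← h]; exact φ.symm_apply_apply _,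
        by rw [← h']; exact φ.symm_apply_apply _⟩,
      fun ⟨φ, h, h'⟩ ⟨ψ, k, k'⟩ => ⟨φ.trans ψ, by rw [← k, ← h]; rfl, by rw [← k', ← h']; rfl⟩⟩

/-- The birooted graph `(B_G(o₁, r), o₁, o₂)`. It makes sense for `r ≥ 1` only, because `o₂` is at
distance `1` from `o₁`. -/
def ball (r : ℕ) (hr : 1 ≤ r) (G : BirootedGraph Δ) : BirootedGraph Δ :=
  { G.toRootedGraph.ball r with
    root₂ := ⟨G.root₂, SimpleGraph.adj_mem_distBall G.adj hr⟩
    adj := G.adj }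

theorem ball_equiv {G H : BirootedGraph Δ} (r : ℕ) (hr : 1 ≤ r) (h : G ≈ H) :
    ball r hr G ≈ ball r hr H := by
  obtain ⟨φ, hφ, hφ'⟩ := h
  exact ⟨SimpleGraph.isoInduce φ _ _
    (SimpleGraph.mem_distBall_iff_of_iso φ G.connected H.connected hφ r), Subtype.ext hφ,
    Subtype.ext hφ'⟩

theorem ball_ball_equiv (G : BirootedGraph Δ) {r s : ℕ} (hr : 1 ≤ r) (hs : 1 ≤ s) (h : r ≤ s) :
    ball r hr (ball s hs G) ≈ ball r hr G :=
  ⟨SimpleGraph.isoBallBall G.connected G.root h, rfl, rfl⟩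

/-- `(G, o₁, o₂) ↦ (G, o₂, o₁)`. -/
def swap (G : BirootedGraph Δ) : BirootedGraph Δ :=
  { G with root := G.root₂, root₂ := G.root, adj := G.adj.symm }

theorem swap_equiv {G H : BirootedGraph Δ} (h : G ≈ H) : swap G ≈ swap H := by
  obtain ⟨φ, hφ, hφ'⟩ := h
  exact ⟨φ, hφ', hφ⟩

end BirootedGraph

/-! ### The spaces of isomorphism classes and their metrics -/

/-- The set of isomorphism classes `[G, o]` of countable, connected rooted graphs with all
degrees at most `Δ`. -/
def Gr (Δ : ℕ) : Type 1 := Quotient (RootedGraph.isoSetoid Δ)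

/-- The set of isomorphism classes `[G, o₁, o₂]` of countable, connected birooted graphs with all
degrees at most `Δ`. -/
def BiGr (Δ : ℕ) : Type 1 := Quotient (BirootedGraph.isoSetoid Δ)

/-- The class `[G, o]`. -/
def Gr.mk {Δ : ℕ} (G : RootedGraph Δ) : Gr Δ := Quotient.mk _ G

/-- The class `[G, o₁, o₂]`. -/
def BiGr.mk {Δ : ℕ} (G : BirootedGraph Δ) : BiGr Δ := Quotient.mk _ G

/-- The map `[G, o] ↦ [B_G(o, r), o]`. -/
def Gr.ball {Δ : ℕ} (r : ℕ) : Gr Δ → Gr Δ :=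
  Quotient.map (RootedGraph.ball r) fun _ _ h => RootedGraph.ball_equiv r h

/-- The map `[G, o₁, o₂] ↦ [B_G(o₁, r), o₁, o₂]`, for `r ≥ 1`. -/
def BiGr.ball {Δ : ℕ} (r : ℕ) (hr : 1 ≤ r) : BiGr Δ → BiGr Δ :=
  Quotient.map (BirootedGraph.ball r hr) fun _ _ h => BirootedGraph.ball_equiv r hr h

/-- The flip `ι [G, x, y] = [G, y, x]`. -/
def BiGr.flip {Δ : ℕ} : BiGr Δ → BiGr Δ :=
  Quotient.map BirootedGraph.swap fun _ _ h => BirootedGraph.swap_equiv h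

open Classical in
/-- `ρ([G, o], [H, p])` is `0` if the two classes are equal, and otherwise `2 ^ (-r)` where `r` is
the supremum of all `s` such that `[B_G(o, s), o] = [B_H(p, s), p]`. -/
noncomputable def Gr.rho {Δ : ℕ} (x y : Gr Δ) : ℝ :=
  if x = y then 0 else (1 / 2) ^ sSup {s : ℕ | x.ball s = y.ball s}

open Classical in
/-- The analogous distance on birooted graphs. The supremum of the empty set is `0`, so that two
classes whose balls of radius `1` differ are at distance `1`. -/
noncomputable def BiGr.rho {Δ : ℕ} (x y : BiGr Δ) : ℝ :=
  if x = y then 0 else (1 / 2) ^ sSup {s : ℕ | ∃ hs : 1 ≤ s, x.ball s hs = y.ball s hs}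

section UltrametricFromAgreement

open Classical in
theorem agreement_triangle {α : Type 1} (A : ℕ → α → α → Prop)
    (trans : ∀ s x y z, A s x y → A s y z → A s x z)
    (anti : ∀ s t x y, 1 ≤ s → s ≤ t → A t x y → A s x y)
    (bdd : ∀ x y, x ≠ y → BddAbove {s | A s x y}) (x y z : α) :
    (if x = z then (0 : ℝ) else (1 / 2) ^ sSup {s | A s x z}) ≤
      (if x = y then (0 : ℝ) else (1 / 2) ^ sSup {s | A s x y}) +
        (if y = z then (0 : ℝ) else (1 / 2) ^ sSup {s | A s y z}) := by
  by_cases hxz : x = z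
  · rw [if_pos hxz]
    positivity
  by_cases hxy : x = y
  · subst hxy
    simp
  by_cases hyz : y = z
  · subst hyz
    simp
  rw [if_neg hxz, if_neg hxy, if_neg hyz]
  have mem : ∀ u v : α, u ≠ v → 1 ≤ sSup {s | A s u v} → A (sSup {s | A s u v}) u v := by
    intro u v huv h
    refine Nat.sSup_mem ?_ (bdd u v huv)
    by_contra hne
    rw [Set.not_nonempty_iff_eq_empty] at hne
    rw [hne] at h
    simp at h
  have key : min (sSup {s | A s x y}) (sSup {s | A s y z}) ≤ sSup {s | A s x z} := by
    by_cases h0 : min (sSup {s | A s x y}) (sSup {s | A s y z}) = 0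
    · omega
    · have h1 : 1 ≤ min (sSup {s | A s x y}) (sSup {s | A s y z}) := Nat.one_le_iff_ne_zero.mpr h0
      refine le_csSup (bdd x z hxz) ?_
      exact trans _ _ _ _
        (anti _ _ _ _ h1 (min_le_left _ _) (mem x y hxy (h1.trans (min_le_left _ _))))
        (anti _ _ _ _ h1 (min_le_right _ _) (mem y z hyz (h1.trans (min_le_right _ _))))
  have hp : ∀ n : ℕ, (0 : ℝ) < (1 / 2) ^ n := fun n => by positivity
  rcases min_choice (sSup {s | A s x y}) (sSup {s | A s y z}) with h | h
  · rw [h] at key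
    have := pow_le_pow_of_le_one (by norm_num : (0 : ℝ) ≤ 1 / 2) (by norm_num) key
    linarith [hp (sSup {s | A s y z})]
  · rw [h] at key
    have := pow_le_pow_of_le_one (by norm_num : (0 : ℝ) ≤ 1 / 2) (by norm_num) key
    linarith [hp (sSup {s | A s x y})]

end UltrametricFromAgreement

namespace Gr

variable {Δ : ℕ}

theorem ball_ball (x : Gr Δ) {r s : ℕ} (h : r ≤ s) : (x.ball s).ball r = x.ball r := by
  induction x using Quotient.inductionOn with
  | h G => exact Quotient.sound (RootedGraph.ball_ball_equiv G h)

theorem ball_eq_of_le {x y : Gr Δ} {r s : ℕ} (h : r ≤ s) (hs : x.ball s = y.ball s) :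
    x.ball r = y.ball r := by
  rw [← ball_ball x h, hs, ball_ball y h]

theorem bddAbove_agree (x y : Gr Δ) (hxy : x ≠ y) : BddAbove {s : ℕ | x.ball s = y.ball s} := by
  by_contra hb
  apply hxy
  induction x using Quotient.inductionOn with
  | h G =>
    induction y using Quotient.inductionOn with
    | h H =>
      rw [not_bddAbove_iff] at hb
      obtain ⟨φ, hφ, -⟩ := SimpleGraph.exists_iso_of_forall_ball G.connected H.connected
        G.finite_neighborSet H.finite_neighborSet G.root H.root (fun _ => True) (fun _ => True)
        (fun n => by
          obtain ⟨s, hs, hn⟩ := hb n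
          obtain ⟨φ, hφ⟩ := Quotient.exact hs
          exact ⟨s, hn.le, φ, congrArg Subtype.val hφ, fun _ => Iff.rfl⟩)
      exact Quotient.sound ⟨φ, hφ⟩

theorem rho_comm (x y : Gr Δ) : rho x y = rho y x := by
  have h : {s : ℕ | x.ball s = y.ball s} = {s : ℕ | y.ball s = x.ball s} := by
    ext s
    exact eq_comm
  by_cases hxy : x = y
  · rw [hxy]
  · rw [rho, rho, if_neg hxy, if_neg (Ne.symm hxy), h]

noncomputable instance : MetricSpace (Gr Δ) where
  dist := rho
  dist_self x := by simp [rho]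
  dist_comm x y := rho_comm x y
  dist_triangle x y z := agreement_triangle (fun s (x y : Gr Δ) => x.ball s = y.ball s)
    (fun _ _ _ _ h k => h.trans k) (fun _ _ _ _ _ h k => ball_eq_of_le h k) bddAbove_agree x y z
  eq_of_dist_eq_zero {x y} h := by
    by_contra hne
    change rho x y = 0 at h
    rw [rho, if_neg hne] at h
    exact absurd h (by positivity)

/-- `Gr Δ` carries the Borel `σ`-algebra of the metric `ρ`. -/
noncomputable instance : MeasurableSpace (Gr Δ) := borel _

instance : BorelSpace (Gr Δ) := ⟨rfl⟩

theorem dist_le_of_ball_eq {x y : Gr Δ} {r : ℕ} (h : x.ball r = y.ball r) :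
    dist x y ≤ (1 / 2) ^ r := by
  change rho x y ≤ _
  rw [rho]
  split_ifs with hxy
  · positivity
  · exact pow_le_pow_of_le_one (by norm_num) (by norm_num) (le_csSup (bddAbove_agree x y hxy) h)

theorem ball_eq_of_dist_lt {x y : Gr Δ} {r : ℕ} (h : dist x y < (1 / 2) ^ r) :
    x.ball r = y.ball r := by
  change rho x y < _ at h
  rw [rho] at h
  split_ifs at h with hxy
  · rw [hxy]
  · have hlt : r < sSup {s : ℕ | x.ball s = y.ball s} := by
      by_contra hle
      exact absurd h (not_lt.mpr
        (pow_le_pow_of_le_one (by norm_num) (by norm_num) (not_lt.mp hle)))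
    obtain ⟨s, hs, hrs⟩ := exists_lt_of_lt_csSup' hlt
    exact ball_eq_of_le hrs.le hs

end Gr

namespace BiGr

variable {Δ : ℕ}

theorem ball_ball (x : BiGr Δ) {r s : ℕ} (hr : 1 ≤ r) (hs : 1 ≤ s) (h : r ≤ s) :
    (x.ball s hs).ball r hr = x.ball r hr := by
  induction x using Quotient.inductionOn with
  | h G => exact Quotient.sound (BirootedGraph.ball_ball_equiv G hr hs h)

theorem ball_eq_of_le {x y : BiGr Δ} {r s : ℕ} (hr : 1 ≤ r) (hs : 1 ≤ s) (h : r ≤ s)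
    (hxy : x.ball s hs = y.ball s hs) : x.ball r hr = y.ball r hr := by
  rw [← ball_ball x hr hs h, hxy, ball_ball y hr hs h]

theorem bddAbove_agree (x y : BiGr Δ) (hxy : x ≠ y) :
    BddAbove {s : ℕ | ∃ hs : 1 ≤ s, x.ball s hs = y.ball s hs} := by
  by_contra hb
  apply hxy
  induction x using Quotient.inductionOn with
  | h G =>
    induction y using Quotient.inductionOn with
    | h H =>
      rw [not_bddAbove_iff] at hb
      obtain ⟨φ, hφ, hφ'⟩ := SimpleGraph.exists_iso_of_forall_ball G.connected H.connected
        G.finite_neighborSet H.finite_neighborSet G.root H.root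
        (fun x => x = G.root₂) (fun y => y = H.root₂)
        (fun n => by
          obtain ⟨s, ⟨h1, hs⟩, hn⟩ := hb n
          obtain ⟨φ, hφ, hφ'⟩ := Quotient.exact hs
          refine ⟨s, hn.le, φ, congrArg Subtype.val hφ, fun x => ?_⟩
          have hr : x.1 = G.root₂ ↔ x = (BirootedGraph.ball s h1 G).root₂ :=
            ⟨fun h => Subtype.ext h, fun h => congrArg Subtype.val h⟩
          have hr' : (φ x).1 = H.root₂ ↔ φ x = (BirootedGraph.ball s h1 H).root₂ :=
            ⟨fun h => Subtype.ext h, fun h => congrArg Subtype.val h⟩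
          refine hr.trans (Iff.trans ?_ hr'.symm)
          rw [← hφ']
          exact φ.injective.eq_iff.symm)
      exact Quotient.sound ⟨φ, hφ, (hφ' _).mp rfl⟩

theorem rho_comm (x y : BiGr Δ) : rho x y = rho y x := by
  have h : {s : ℕ | ∃ hs : 1 ≤ s, x.ball s hs = y.ball s hs} =
      {s : ℕ | ∃ hs : 1 ≤ s, y.ball s hs = x.ball s hs} := by
    ext s
    exact exists_congr fun _ => eq_comm
  by_cases hxy : x = y
  · rw [hxy]
  · rw [rho, rho, if_neg hxy, if_neg (Ne.symm hxy), h]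

noncomputable instance : MetricSpace (BiGr Δ) where
  dist := rho
  dist_self x := by simp [rho]
  dist_comm x y := rho_comm x y
  dist_triangle x y z :=
    agreement_triangle (fun s (x y : BiGr Δ) => ∃ hs : 1 ≤ s, x.ball s hs = y.ball s hs)
      (fun _ _ _ _ ⟨h, k⟩ ⟨_, k'⟩ => ⟨h, k.trans k'⟩)
      (fun _ _ _ _ hr h ⟨hs, k⟩ => ⟨hr, ball_eq_of_le hr hs h k⟩) bddAbove_agree x y z
  eq_of_dist_eq_zero {x y} h := by
    by_contra hne
    change rho x y = 0 at h
    rw [rho, if_neg hne] at h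
    exact absurd h (by positivity)

/-- `BiGr Δ` carries the Borel `σ`-algebra of its metric. -/
noncomputable instance : MeasurableSpace (BiGr Δ) := borel _

instance : BorelSpace (BiGr Δ) := ⟨rfl⟩

theorem dist_le_of_ball_eq {x y : BiGr Δ} {r : ℕ} (hr : 1 ≤ r) (h : x.ball r hr = y.ball r hr) :
    dist x y ≤ (1 / 2) ^ r := by
  change rho x y ≤ _
  rw [rho]
  split_ifs with hxy
  · positivity
  · exact pow_le_pow_of_le_one (by norm_num) (by norm_num)
      (le_csSup (bddAbove_agree x y hxy) ⟨hr, h⟩)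

end BiGr

/-! ### The measure on birooted graphs and involution invariance -/

namespace RootedGraph

variable {Δ : ℕ}

/-- The set of the neighbours `x` of the root `o` of `(G, o)` such that `[G, o, x] ∈ A`. -/
def neighborsIn (A : Set (BiGr Δ)) (G : RootedGraph Δ) : Set G.V :=
  {x | ∃ h : G.graph.Adj G.root x, BiGr.mk (G.withRoot₂ x h) ∈ A}

theorem finite_neighborsIn (A : Set (BiGr Δ)) (G : RootedGraph Δ) : (G.neighborsIn A).Finite :=
  (G.finite_neighborSet G.root).subset fun _ hx => hx.1

theorem ncard_neighborsIn_eq (A : Set (BiGr Δ)) {G H : RootedGraph Δ} (h : G ≈ H) :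
    (G.neighborsIn A).ncard = (H.neighborsIn A).ncard := by
  obtain ⟨φ, hφ⟩ := h
  have : H.neighborsIn A = φ '' G.neighborsIn A := by
    ext y
    constructor
    · rintro ⟨hy, hA⟩
      have hadj : G.graph.Adj G.root (φ.symm y) := by
        rw [← φ.map_adj_iff, hφ]
        simpa using hy
      refine ⟨φ.symm y, ⟨hadj, ?_⟩, by simp⟩
      have he : BiGr.mk (G.withRoot₂ (φ.symm y) hadj) = BiGr.mk (H.withRoot₂ y hy) :=
        Quotient.sound ⟨φ, hφ, φ.apply_symm_apply y⟩
      rw [he]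
      exact hA
    · rintro ⟨x, ⟨hx, hA⟩, rfl⟩
      have hadj : H.graph.Adj H.root (φ x) := by
        rw [← hφ]
        exact φ.map_adj_iff.mpr hx
      refine ⟨hadj, ?_⟩
      have he : BiGr.mk (G.withRoot₂ x hx) = BiGr.mk (H.withRoot₂ (φ x) hadj) :=
        Quotient.sound ⟨φ, hφ, rfl⟩
      rw [← he]
      exact hA
  rw [this, Set.ncard_image_of_injective _ φ.injective]

end RootedGraph

namespace Gr

variable {Δ : ℕ}

/-- The function `f_A [G, o] = |{x ∈ N_G(o) : [G, o, x] ∈ A}|`. -/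
noncomputable def neighborCount (A : Set (BiGr Δ)) : Gr Δ → ℕ :=
  Quotient.lift (fun G => (G.neighborsIn A).ncard) fun _ _ h =>
    RootedGraph.ncard_neighborsIn_eq A h

theorem neighborCount_empty (x : Gr Δ) : neighborCount ∅ x = 0 := by
  induction x using Quotient.inductionOn with
  | h G => simp [neighborCount, RootedGraph.neighborsIn]

theorem neighborCount_iUnion (f : ℕ → Set (BiGr Δ)) (hf : Pairwise (Function.onFun Disjoint f))
    (x : Gr Δ) :
    (neighborCount (⋃ i, f i) x : ℝ≥0∞) = ∑' i, (neighborCount (f i) x : ℝ≥0∞) := by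
  induction x using Quotient.inductionOn with
  | h G =>
    let : MeasurableSpace G.V := ⊤
    have hc : ∀ A : Set (BiGr Δ), (neighborCount A (Quotient.mk _ G) : ℝ≥0∞) =
        Measure.count (G.neighborsIn A) := by
      intro A
      rw [Measure.count_apply MeasurableSpace.measurableSet_top]
      rw [← (G.finite_neighborsIn A).cast_ncard_eq]
      simp [neighborCount]
    simp only [hc]
    rw [← measure_iUnion]
    · congr 1
      ext x
      simp only [RootedGraph.neighborsIn, Set.mem_iUnion, Set.mem_ofPred_eq]
      tauto
    · intro i j hij
      rw [Function.onFun, Set.disjoint_left]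
      rintro x ⟨h, h1⟩ ⟨_, h2⟩
      exact Set.disjoint_left.mp (hf hij) h1 h2
    · exact fun _ => MeasurableSpace.measurableSet_top

theorem neighborCount_compl (A : Set (BiGr Δ)) (x : Gr Δ) :
    neighborCount Aᶜ x = neighborCount Set.univ x - neighborCount A x := by
  induction x using Quotient.inductionOn with
  | h G =>
    have : G.neighborsIn Aᶜ = G.neighborsIn Set.univ \ G.neighborsIn A := by
      ext x
      simp only [RootedGraph.neighborsIn, Set.mem_compl_iff, Set.mem_ofPred_eq, Set.mem_univ,
        Set.mem_sdiff]
      constructor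
      · rintro ⟨h, h'⟩
        exact ⟨⟨h, trivial⟩, fun ⟨_, k⟩ => h' k⟩
      · rintro ⟨⟨h, _⟩, h'⟩
        exact ⟨h, fun k => h' ⟨h, k⟩⟩
    change (G.neighborsIn Aᶜ).ncard = (G.neighborsIn _).ncard - (G.neighborsIn A).ncard
    rw [this, Set.ncard_sdiff _ (G.finite_neighborsIn A)]
    exact fun x ⟨h, _⟩ => ⟨h, trivial⟩

theorem neighborCount_le_of_isOpen {A : Set (BiGr Δ)} (hA : IsOpen A) (x : Gr Δ) :
    ∃ r, ∀ y : Gr Δ, x.ball r = y.ball r → neighborCount A x ≤ neighborCount A y := by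
  induction x using Quotient.inductionOn with
  | h G =>
    have h1 : ∀ v ∈ G.neighborsIn A, ∀ᶠ r : ℕ in atTop,
        ∀ (h : G.graph.Adj G.root v) (hr : 1 ≤ r) (z : BiGr Δ),
          z.ball r hr = (BiGr.mk (G.withRoot₂ v h)).ball r hr → z ∈ A := by
      rintro v ⟨h, hv⟩
      obtain ⟨ε, hε, hball⟩ := Metric.isOpen_iff.mp hA _ hv
      have ht := tendsto_pow_atTop_nhds_zero_of_lt_one (by norm_num : (0 : ℝ) ≤ 1 / 2) (by norm_num)
      filter_upwards [ht.eventually (gt_mem_nhds hε)] with r hr h' h1 z hz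
      exact hball (lt_of_le_of_lt (BiGr.dist_le_of_ball_eq h1 hz) hr)
    obtain ⟨r, hr, hr1⟩ := (((Set.Finite.eventually_all (G.finite_neighborsIn A)).mpr h1).and
      (eventually_ge_atTop 1)).exists
    refine ⟨r, fun y hy => ?_⟩
    induction y using Quotient.inductionOn with
    | h H =>
      obtain ⟨φ, hφ⟩ := Quotient.exact hy
      change (G.neighborsIn A).ncard ≤ (H.neighborsIn A).ncard
      classical
      have hm : ∀ v ∈ G.neighborsIn A, v ∈ G.graph.distBall G.root r := fun v hv =>
        SimpleGraph.adj_mem_distBall hv.1 hr1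
      let f : G.V → H.V := fun v =>
        if h : v ∈ G.graph.distBall G.root r then (φ ⟨v, h⟩).1 else H.root
      have hf : ∀ v (hv : v ∈ G.graph.distBall G.root r), f v = (φ ⟨v, hv⟩).1 :=
        fun v hv => dif_pos hv
      refine Set.ncard_le_ncard_of_injOn f ?_ ?_ (H.finite_neighborsIn A)
      · intro v hv
        have hadj := hv.1
        have hadj' : H.graph.Adj H.root (f v) := by
          rw [hf v (hm v hv)]
          have h3 : (G.ball r).graph.Adj (G.ball r).root ⟨v, hm v hv⟩ := hadj
          have h4 := φ.map_adj_iff.mpr h3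
          rw [hφ] at h4
          exact h4
        refine ⟨hadj', hr v hv hadj hr1 _ ?_⟩
        refine Quotient.sound ⟨φ.symm, ?_, ?_⟩
        · change φ.symm (H.ball r).root = (G.ball r).root
          rw [← hφ]
          exact φ.symm_apply_apply _
        · refine (φ.symm_apply_eq).mpr (Subtype.ext ?_)
          exact hf v (hm v hv)
      · intro v hv w hw hvw
        rw [hf v (hm v hv), hf w (hm w hw)] at hvw
        exact congrArg Subtype.val (φ.injective (Subtype.ext hvw))

theorem measurable_neighborCount_of_isOpen {A : Set (BiGr Δ)} (hA : IsOpen A) :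
    Measurable (neighborCount A) := by
  refine measurable_of_Ici fun k => IsOpen.measurableSet ?_
  rw [Metric.isOpen_iff]
  intro x hx
  obtain ⟨r, hr⟩ := neighborCount_le_of_isOpen hA x
  refine ⟨(1 / 2) ^ r, by positivity, fun y hy => ?_⟩
  exact le_trans (Set.mem_Ici.mp hx) (hr y (ball_eq_of_dist_lt hy).symm)

theorem measurable_neighborCount {A : Set (BiGr Δ)} (hA : MeasurableSet A) :
    Measurable fun x => (neighborCount A x : ℝ≥0∞) := by
  have hcast : Measurable fun n : ℕ => (n : ℝ≥0∞) := measurable_from_top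
  induction A, hA using MeasurableSpace.induction_on_inter
    (BorelSpace.measurable_eq (α := BiGr Δ)) isPiSystem_isOpen with
  | empty => simp [neighborCount_empty]
  | basic t ht => exact hcast.comp (measurable_neighborCount_of_isOpen ht)
  | compl t _ ih =>
    simp only [neighborCount_compl, ENNReal.natCast_sub]
    exact (hcast.comp (measurable_neighborCount_of_isOpen isOpen_univ)).sub ih
  | iUnion f hd _ ih =>
    simp only [neighborCount_iUnion f hd]
    exact Measurable.tsum ih

/-- The measure `μ⃗` on `BiGr Δ` given by `μ⃗(A) = ∫ f_A dμ` for all Borel sets `A`. -/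
noncomputable def vec (μ : Measure (Gr Δ)) : Measure (BiGr Δ) :=
  Measure.ofMeasurable (fun A _ => ∫⁻ x, (neighborCount A x : ℝ≥0∞) ∂μ)
    (by simp [neighborCount_empty])
    (fun f hf hd => by
      simp only [neighborCount_iUnion f hd]
      exact lintegral_tsum fun i => (measurable_neighborCount (hf i)).aemeasurable)

theorem vec_apply (μ : Measure (Gr Δ)) {A : Set (BiGr Δ)} (hA : MeasurableSet A) :
    vec μ A = ∫⁻ x, (neighborCount A x : ℝ≥0∞) ∂μ :=
  Measure.ofMeasurable_apply A hA

/-- A measure `μ` on `Gr Δ` is involution invariant if the flip `ι` pushes `μ⃗` forward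
to `μ⃗`. -/
def InvolutionInvariant (μ : Measure (Gr Δ)) : Prop :=
  Measure.map BiGr.flip (vec μ) = vec μ

end Gr

/-! ### Balls around the second root -/

namespace BirootedGraph

variable {Δ : ℕ}

/-! Weak convergence gives `∫ f dμₙ → ∫ f dμ` only for bounded continuous `f`, so `μ⃗` is tested on
sets `A` for which `f_A = neighborCount A` is continuous. Clopen sets have this property: `f_A` is
lower semicontinuous for open `A` (`neighborCount_le_of_isOpen`), and `f_A` and the count for the
complement add up to the degree of the root, which is locally constant. Since `0 ≤ f_A ≤ Δ`, it
follows that `μ⃗ₙ(A) → μ⃗(A)` for clopen `A` (`tendsto_vec_of_isClopen`).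

The flip is continuous, because the ball of radius `r` around `o₂` already lies in the ball of
radius `r + 1` around `o₁`. Hence the preimage of a clopen `A` is clopen, and `μ⃗(ι⁻¹A)` and `μ⃗(A)`
are limits of one and the same sequence.

The space is zero-dimensional in a strong sense: every open set is a countable union of clopen sets.
So the clopen sets form a π-system generating the Borel σ-algebra, and two finite measures with the
same values on them coincide. -/

theorem distBall_root₂_subset (G : BirootedGraph Δ) (r : ℕ) :
    G.graph.distBall G.root₂ r ⊆ G.graph.distBall G.root (r + 1) := by
  intro x hx
  have h1 : G.graph.dist G.root G.root₂ = 1 := SimpleGraph.dist_eq_one_iff_adj.mpr G.adj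
  have h2 := G.connected.dist_triangle (u := G.root) (v := G.root₂) (w := x)
  simp only [SimpleGraph.distBall, Set.mem_ofPred_eq] at hx ⊢
  omega

/-- Passing to a ball around `o₁` could lengthen distances from `o₂`, as a geodesic may leave the
ball. A geodesic from `o₂` of length at most `r` stays within distance `r` of `o₂`, hence inside the
ball when `r + 1 ≤ s`. -/
theorem mem_distBall_swap_ball_iff (G : BirootedGraph Δ) {r s : ℕ} (hrs : r + 1 ≤ s)
    (hs : 1 ≤ s) (x : (ball s hs G).V) :
    x ∈ (ball s hs G).graph.distBall (ball s hs G).root₂ r ↔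
      x.1 ∈ G.graph.distBall G.root₂ r := by
  constructor
  · intro hx
    -- The inclusion of an induced connected subgraph cannot increase distances.
    exact (SimpleGraph.dist_apply_le
      (SimpleGraph.Embedding.induce (G.graph.distBall G.root s)).toHom
      (ball s hs G).connected (ball s hs G).root₂ x).trans hx
  · intro hx
    obtain ⟨p, hp⟩ := SimpleGraph.exists_induced_walk G.connected G.root₂ r x.1 hx
    have hsub : G.graph.distBall G.root₂ r ⊆ G.graph.distBall G.root s :=
      fun y hy => le_trans (G.distBall_root₂_subset r hy) hrs
    have h := SimpleGraph.dist_le (p.map (SimpleGraph.induceHomOfLE G.graph hsub).toHom)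
    rw [SimpleGraph.Walk.length_map, hp] at h
    exact h.trans hx

/-- The ball of radius `r` around the second root is contained in every ball of radius `s ≥ r + 1`
around the first root. -/
theorem ball_swap_ball_equiv (G : BirootedGraph Δ) {r s : ℕ} (hr : 1 ≤ r) (hs : 1 ≤ s)
    (hrs : r + 1 ≤ s) : ball r hr (swap (ball s hs G)) ≈ ball r hr (swap G) :=
  ⟨{ toFun := fun x => ⟨x.1.1, (G.mem_distBall_swap_ball_iff hrs hs x.1).mp x.2⟩
     invFun := fun x =>
      ⟨⟨x.1, le_trans (G.distBall_root₂_subset r x.2) hrs⟩,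
        (G.mem_distBall_swap_ball_iff hrs hs _).mpr x.2⟩
     left_inv := fun _ => rfl
     right_inv := fun _ => rfl
     map_rel_iff' := Iff.rfl }, rfl, rfl⟩

end BirootedGraph

/-! ### Continuity of the flip and clopen sets of birooted graphs -/

namespace BiGr

variable {Δ : ℕ}

theorem ball_eq_of_dist_lt {x y : BiGr Δ} {r : ℕ} (hr : 1 ≤ r) (h : dist x y < (1 / 2) ^ r) :
    x.ball r hr = y.ball r hr := by
  change rho x y < _ at h
  rw [rho] at h
  split_ifs at h with hxy
  · rw [hxy]
  · have hlt : r < sSup {s : ℕ | ∃ hs : 1 ≤ s, x.ball s hs = y.ball s hs} := by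
      by_contra hle
      exact absurd h (not_lt.mpr
        (pow_le_pow_of_le_one (by norm_num) (by norm_num) (not_lt.mp hle)))
    obtain ⟨s, ⟨hs, hxy⟩, hrs⟩ := exists_lt_of_lt_csSup' hlt
    exact ball_eq_of_le hr hs hrs.le hxy

theorem exists_half_pow_lt {ε : ℝ} (hε : 0 < ε) : ∃ r, 1 ≤ r ∧ (1 / 2 : ℝ) ^ r < ε := by
  have ht := tendsto_pow_atTop_nhds_zero_of_lt_one (by norm_num : (0 : ℝ) ≤ 1 / 2) (by norm_num)
  exact ((eventually_ge_atTop 1).and (ht.eventually (gt_mem_nhds hε))).exists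

theorem ball_flip_ball (x : BiGr Δ) {r s : ℕ} (hr : 1 ≤ r) (hs : 1 ≤ s) (hrs : r + 1 ≤ s) :
    (x.ball s hs).flip.ball r hr = x.flip.ball r hr := by
  induction x using Quotient.inductionOn with
  | h G => exact Quotient.sound (G.ball_swap_ball_equiv hr hs hrs)

/-- Agreement up to radius `r + 1` survives the flip up to radius `r`. -/
theorem continuous_flip : Continuous (flip : BiGr Δ → BiGr Δ) := by
  rw [Metric.continuous_iff]
  intro x ε hε
  obtain ⟨r, hr, hrε⟩ := exists_half_pow_lt hε
  refine ⟨(1 / 2) ^ (r + 1), by positivity, fun y hy => ?_⟩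
  have h := ball_eq_of_dist_lt (Nat.le_add_left 1 r) hy
  refine lt_of_le_of_lt (dist_le_of_ball_eq hr ?_) hrε
  rw [← ball_flip_ball y hr (Nat.le_add_left 1 r) le_rfl, h,
    ball_flip_ball x hr (Nat.le_add_left 1 r) le_rfl]

theorem isOpen_of_ball_saturated {A : Set (BiGr Δ)} {r : ℕ} (hr : 1 ≤ r)
    (hA : ∀ x ∈ A, ∀ y, x.ball r hr = y.ball r hr → y ∈ A) : IsOpen A := by
  rw [Metric.isOpen_iff]
  exact fun x hx => ⟨(1 / 2) ^ r, by positivity,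
    fun y hy => hA x hx y (ball_eq_of_dist_lt hr hy).symm⟩

/-- Having the same ball of radius `r` is an equivalence relation with open classes, so the
complement of a union of classes is again such a union. -/
theorem isClopen_of_ball_saturated {A : Set (BiGr Δ)} {r : ℕ} (hr : 1 ≤ r)
    (hA : ∀ x ∈ A, ∀ y, x.ball r hr = y.ball r hr → y ∈ A) : IsClopen A :=
  ⟨⟨isOpen_of_ball_saturated hr fun x hx y hxy hy => hx (hA y hy x hxy.symm)⟩,
    isOpen_of_ball_saturated hr hA⟩

theorem exists_isClopen_iUnion_eq {U : Set (BiGr Δ)} (hU : IsOpen U) :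
    ∃ f : ℕ → Set (BiGr Δ), (∀ n, IsClopen (f n)) ∧ ⋃ n, f n = U := by
  -- The `n`-th set collects the points whose whole class at radius `n + 1` lies in `U`; the shift
  -- is needed because radii start at `1`.
  refine ⟨fun n => {x | ∀ y, x.ball (n + 1) (Nat.le_add_left 1 n) =
    y.ball (n + 1) (Nat.le_add_left 1 n) → y ∈ U}, fun n => ?_, ?_⟩
  · exact isClopen_of_ball_saturated (Nat.le_add_left 1 n)
      fun x hx y hxy z hyz => hx z (hxy.trans hyz)
  · ext x
    rw [Set.mem_iUnion]
    constructor
    · rintro ⟨n, hn⟩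
      exact hn x rfl
    · intro hx
      obtain ⟨ε, hε, hball⟩ := Metric.isOpen_iff.mp hU x hx
      obtain ⟨r, hr, hrε⟩ := exists_half_pow_lt hε
      obtain ⟨n, rfl⟩ := Nat.exists_eq_add_of_le' hr
      exact ⟨n, fun y hy => hball (lt_of_le_of_lt (dist_le_of_ball_eq hr hy.symm) hrε)⟩

/-- Open sets are countable unions of clopen sets, so no separability of the space is needed. -/
theorem measurableSpace_eq_generateFrom_isClopen :
    (inferInstance : MeasurableSpace (BiGr Δ)) =
      MeasurableSpace.generateFrom {A : Set (BiGr Δ) | IsClopen A} := by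
  apply le_antisymm
  · refine MeasurableSpace.generateFrom_le fun U hU => ?_
    obtain ⟨f, hf, rfl⟩ := exists_isClopen_iUnion_eq hU
    exact MeasurableSet.iUnion fun n => MeasurableSpace.measurableSet_generateFrom (hf n)
  · exact MeasurableSpace.generateFrom_le fun A hA => IsOpen.measurableSet hA.isOpen

end BiGr

/-! ### Continuity of the neighbour counts and convergence on clopen sets -/

namespace Gr

variable {Δ : ℕ}

theorem neighborCount_mono {A B : Set (BiGr Δ)} (h : A ⊆ B) (x : Gr Δ) :
    neighborCount A x ≤ neighborCount B x := by
  induction x using Quotient.inductionOn with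
  | h G => exact Set.ncard_le_ncard (fun _ ⟨hv, hA⟩ => ⟨hv, h hA⟩) (G.finite_neighborsIn B)

theorem neighborCount_le (A : Set (BiGr Δ)) (x : Gr Δ) : neighborCount A x ≤ Δ := by
  induction x using Quotient.inductionOn with
  | h G =>
    change (G.neighborsIn A).ncard ≤ Δ
    have h : (G.neighborsIn A).encard ≤ Δ :=
      (Set.encard_le_encard fun _ hv => hv.1).trans (G.degree_le G.root)
    rw [← (G.finite_neighborsIn A).cast_ncard_eq] at h
    exact_mod_cast h

/-- The degree of the root is visible in the ball of radius `1`, hence locally constant. -/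
theorem neighborCount_univ_ball (x : Gr Δ) {r : ℕ} (hr : 1 ≤ r) :
    neighborCount Set.univ (x.ball r) = neighborCount Set.univ x := by
  induction x using Quotient.inductionOn with
  | h G =>
    change ((G.ball r).neighborsIn Set.univ).ncard = (G.neighborsIn Set.univ).ncard
    have h : G.neighborsIn Set.univ =
        (Subtype.val : (G.ball r).V → G.V) '' (G.ball r).neighborsIn Set.univ := by
      ext v
      constructor
      · rintro ⟨hv, -⟩
        exact ⟨⟨v, SimpleGraph.adj_mem_distBall hv hr⟩, ⟨hv, trivial⟩, rfl⟩
      · rintro ⟨w, ⟨hw, -⟩, rfl⟩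
        exact ⟨hw, trivial⟩
    rw [h]
    exact (Set.ncard_image_of_injective _ Subtype.val_injective).symm

/-- Near `x` neither the count for `A` nor that for `Aᶜ` can drop, while their sum, the degree of
the root, stays fixed. So neither can grow. -/
theorem exists_neighborCount_eq_of_ball_eq {A : Set (BiGr Δ)} (hA : IsClopen A) (x : Gr Δ) :
    ∃ r, ∀ y : Gr Δ, x.ball r = y.ball r → neighborCount A y = neighborCount A x := by
  obtain ⟨r, hr⟩ := neighborCount_le_of_isOpen hA.isOpen x
  obtain ⟨s, hs⟩ := neighborCount_le_of_isOpen hA.compl.isOpen x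
  -- The `1` guarantees that the balls determine the degree of the root.
  refine ⟨max 1 (max r s), fun y hy => ?_⟩
  have h1 := hr y (ball_eq_of_le (by omega) hy)
  have h2 := hs y (ball_eq_of_le (by omega) hy)
  have h3 : neighborCount Set.univ x = neighborCount Set.univ y := by
    rw [← neighborCount_univ_ball x le_rfl, ball_eq_of_le (le_max_left _ _) hy,
      neighborCount_univ_ball y le_rfl]
  rw [neighborCount_compl, neighborCount_compl] at h2
  -- These two bounds make the truncated subtractions in `h2` genuine ones.
  have h4 := neighborCount_mono (Set.subset_univ A) x
  have h5 := neighborCount_mono (Set.subset_univ A) y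
  omega

theorem continuous_neighborCount {A : Set (BiGr Δ)} (hA : IsClopen A) :
    Continuous (neighborCount A) := by
  refine (IsLocallyConstant.iff_exists_open _).mpr (fun x => ?_) |>.continuous
  obtain ⟨r, hr⟩ := exists_neighborCount_eq_of_ball_eq hA x
  exact ⟨Metric.ball x ((1 / 2) ^ r), Metric.isOpen_ball, Metric.mem_ball_self (by positivity),
    fun y hy => hr y (ball_eq_of_dist_lt hy).symm⟩

/-- The bounded continuous function `f_A` for a clopen set `A`. -/
noncomputable def neighborCountBCF {A : Set (BiGr Δ)} (hA : IsClopen A) :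
    BoundedContinuousFunction (Gr Δ) NNReal :=
  -- The bound asked for is on the distance between two values; both lie in `[0, Δ]`.
  .mkOfBound ⟨fun x => neighborCount A x, continuous_of_discreteTopology.comp
    (continuous_neighborCount hA)⟩ Δ fun x y => by
      have hx : (neighborCount A x : ℝ) ≤ Δ := by exact_mod_cast neighborCount_le A x
      have hy : (neighborCount A y : ℝ) ≤ Δ := by exact_mod_cast neighborCount_le A y
      have hx0 : (0 : ℝ) ≤ neighborCount A x := Nat.cast_nonneg _
      have hy0 : (0 : ℝ) ≤ neighborCount A y := Nat.cast_nonneg _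
      simp only [ContinuousMap.coe_mk, NNReal.dist_eq, NNReal.coe_natCast]
      exact abs_sub_le_iff.mpr ⟨by linarith, by linarith⟩

/-- By definition `μ⃗(A)` is the integral of `f_A`, a legitimate test function for weak convergence
when `A` is clopen. -/
theorem tendsto_vec_of_isClopen {μs : ℕ → ProbabilityMeasure (Gr Δ)}
    {μ : ProbabilityMeasure (Gr Δ)} (hlim : Tendsto μs atTop (𝓝 μ)) {A : Set (BiGr Δ)}
    (hA : IsClopen A) :
    Tendsto (fun n => vec (μs n : Measure (Gr Δ)) A) atTop (𝓝 (vec (μ : Measure (Gr Δ)) A)) := by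
  have h := (ProbabilityMeasure.tendsto_iff_forall_lintegral_tendsto.mp hlim) (neighborCountBCF hA)
  simpa only [vec_apply _ hA.isOpen.measurableSet, neighborCountBCF,
    BoundedContinuousFunction.mkOfBound_coe, ContinuousMap.coe_mk, ENNReal.coe_natCast] using h

/-- The degree bound gives total mass at most `Δ · μ(univ)`; finiteness is what uniqueness on a
π-system requires. -/
instance isFiniteMeasure_vec (μ : Measure (Gr Δ)) [IsFiniteMeasure μ] :
    IsFiniteMeasure (vec μ) := by
  refine ⟨?_⟩
  rw [vec_apply _ MeasurableSet.univ]
  refine lt_of_le_of_lt (lintegral_mono (g := fun _ => (Δ : ℝ≥0∞)) fun x => ?_) ?_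
  · exact Nat.cast_le.mpr (neighborCount_le _ x)
  · rw [lintegral_const]
    exact ENNReal.mul_lt_top (ENNReal.natCast_lt_top Δ) (measure_lt_top μ _)

end Gr

/-! ### Passing to the limit -/

theorem mainTheorem4 (Δ : ℕ) (hΔ : 0 < Δ) (μs : ℕ → ProbabilityMeasure (Gr Δ))
    (μ : ProbabilityMeasure (Gr Δ))
    (hinv : ∀ n, Gr.InvolutionInvariant (μs n : Measure (Gr Δ)))
    (hlim : Tendsto μs atTop (𝓝 μ)) :
    Gr.InvolutionInvariant (μ : Measure (Gr Δ)) := by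
  have hflip : Measurable (BiGr.flip : BiGr Δ → BiGr Δ) := BiGr.continuous_flip.measurable
  have key : ∀ A : Set (BiGr Δ), IsClopen A →
      Measure.map BiGr.flip (Gr.vec (μ : Measure (Gr Δ))) A = Gr.vec (μ : Measure (Gr Δ)) A := by
    intro A hA
    have hm : MeasurableSet A := hA.isOpen.measurableSet
    rw [Measure.map_apply hflip hm]
    -- By invariance of each `μₙ`, the sequences `μ⃗ₙ(ι⁻¹A)` and `μ⃗ₙ(A)` are equal, so their limits
    -- agree.
    refine tendsto_nhds_unique
      (Gr.tendsto_vec_of_isClopen hlim (hA.preimage BiGr.continuous_flip)) ?_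
    refine (Gr.tendsto_vec_of_isClopen hlim hA).congr fun n => ?_
    rw [← Measure.map_apply hflip hm, hinv n]
  -- Equality of the total masses is the case of the clopen set `Set.univ`.
  exact ext_of_generate_finite _ BiGr.measurableSpace_eq_generateFrom_isClopen
    (fun _ hA _ hB _ => hA.inter hB) key (key _ isClopen_univ)
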